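/- Fix a finite gate set of admissible (completely positive, trace-preserving) maps on qubits that contains the usual universal elementary gates: preparing $|0\rangle$, discarding or measuring a qubit, NOT, $H$, $T$ and CNOT. A quantum polynomial-time algorithm (QPT) is a family of circuits over this gate set (possibly with oracle gates), one for each security parameter $n$, whose descriptions are printed by a single polynomial-time Turing machine on input $1^n$. A function $\varepsilon:\mathbb N\to\mathbb R$ is negligible if $n^k\varepsilon(n)\to 0$ for every $k$. A quantum public-key encryption scheme is a triple of QPTs $(\mathsf{KeyGen},\mathsf{Enc},\mathsf{Dec})$, where $\mathsf{KeyGen}(1^n)$ outputs a pair $(pk,sk)$ of classical strings with $|sk|=n$, $\mathsf{Enc}_{pk}$ maps states of a message register $M$ to states of a ciphertext register $C$, $\mathsf{Dec}_{sk}$ maps states of $C$ to states of $M$, and $\|\mathsf{Dec}_{sk}\circ\mathsf{Enc}_{pk}-\mathbb 1_M\|_\diamond\le\varepsilon(n)$ for one negligible $\varepsilon$ and all $(pk,sk)$ in the support of $\mathsf{KeyGen}(1^n)$. A quantum symmetric-key encryption scheme is the same with a single key $pk=sk=k\in\{0,1\}^n$. An adversary is a pair $(\mathcal M,\mathcal D)$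 of QPTs. The message generator $\mathcal M$ receives $pk$ (in the symmetric-key setting: a blank input) and prepares a state $\rho_{ME}$ of the message register and an auxiliary register $E$. Put $\rho^{(1)}_{ME}=\rho_{ME}$ and $\rho^{(0)}_{ME}=|0\rangle\langle 0|_M\otimes\operatorname{tr}_M\rho_{ME}$. The distinguisher $\mathcal D$ receives $(\mathsf{Enc}_{pk}\otimes\mathbb 1_E)\rho^{(b)}_{ME}$ and outputs a bitstring, whose length may depend on $n$. In the plain games there are no oracles; in the CPA games $\mathcal M$ and $\mathcal D$ have an oracle for $\mathsf{Enc}_{pk}$; in the CCA1 games $\mathcal M$ has in addition an oracle for $\mathsf{Dec}_{sk}$. All probabilities below are over $\mathsf{KeyGen}(1^n)$ and all internal randomness. The scheme is IND secure if for every adversary there is a negligible $\varepsilon$ with $$\mathrm{Adv}(n):=\Bigl|\Pr\bigl[\mathcal D\{(\mathsf{Enc}_{pk}\otimes\mathbb 1_E)\rho^{(1)}_{ME}\}=1\bigr]-\Pr\bigl[\mathcal D\{(\mathsf{Enc}_{pk}\otimes\mathbb 1_E)\rho^{(0)}_{ME}\}=1\bigr]\Bigr|\le\varepsilon(n)\quad\text{for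 all }n.$$ It is IND$'$ secure if for every adversary there is a negligible $\varepsilon$ such that, for a uniformly random bit $b$, $$\Pr\bigl[\mathcal D\{(\mathsf{Enc}_{pk}\otimes\mathbb 1_E)\rho^{(b)}_{ME}\}=b\bigr]\le\tfrac12+\varepsilon(n)\quad\text{for all }n.$$ **Proposition.** Let a public-key or symmetric-key quantum encryption scheme be given, and consider the plain, the CPA, or the CCA1 games. The scheme is IND$'$ secure if and only if it is IND secure. Moreover, for every adversary $(\mathcal M,\mathcal D)$ there is a QPT $\mathcal D\oplus 1$ with the same oracles and registers which, on every input and for each $c\in\{0,1\}$, outputs the one-bit string $c$ with the probability with which $\mathcal D$ outputs $1-c$; and for every $n$ for which the output of $\mathcal D$ is a single bit, $$\mathrm{Adv}(n)=2\max\Bigl\{\Pr\bigl[\mathcal D\{(\mathsf{Enc}_{pk}\otimes\mathbb 1_E)\rho^{(b)}_{ME}\}=b\bigr]-\tfrac12,\ \Pr\bigl[(\mathcal D\oplus 1)\{(\mathsf{Enc}_{pk}\otimes\mathbb 1_E)\rho^{(b)}_{ME}\}=b\bigr]-\tfrac12\Bigr\}.$$ -/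

import Mathlib

noncomputable section

namespace QEnc

open scoped ComplexOrder

/-! ### Qubit registers, operators and superoperators -/

/-- Bitstrings of length `k`; they index the computational basis of `k` qubits. -/
abbrev Bits (k : ℕ) : Type := Fin k → Bool

/-- Linear operators on the space of `k` qubits, in the computational basis. -/
abbrev Operator (k : ℕ) : Type := Matrix (Bits k) (Bits k) ℂ

/-- Linear maps from operators on `a` qubits to operators on `b` qubits. -/
abbrev SuperOp (a b : ℕ) : Type := Operator a →ₗ[ℂ] Operator b

/-- The pure basis state `|x⟩⟨x|`. -/
def basisState {k : ℕ} (x : Bits k) : Operator k := Matrix.single x x 1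

/-- The all-zero state `|0⟩⟨0|`. -/
def zeroState (k : ℕ) : Operator k := basisState fun _ => false

/-- `Φ ⊗ 1_R`, acting on the left factor. -/
def tensorId {A B : Type} (R : Type) (Φ : Matrix A A ℂ →ₗ[ℂ] Matrix B B ℂ) :
    Matrix (A × R) (A × R) ℂ →ₗ[ℂ] Matrix (B × R) (B × R) ℂ where
  toFun X := Matrix.of fun p q => Φ (Matrix.of fun x y => X (x, p.2) (y, q.2)) p.1 q.1
  map_add' X Y := by
    ext p q
    exact congrFun (congrFun (map_add Φ (Matrix.of fun x y => X (x, p.2) (y, q.2))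
      (Matrix.of fun x y => Y (x, p.2) (y, q.2))) p.1) q.1
  map_smul' c X := by
    ext p q
    exact congrFun (congrFun (map_smul Φ c (Matrix.of fun x y => X (x, p.2) (y, q.2))) p.1) q.1

/-- Admissible maps: completely positive and trace preserving. -/
def IsAdmissible {a b : ℕ} (Φ : SuperOp a b) : Prop :=
  (∀ (k : ℕ) (X : Matrix (Bits a × Fin k) (Bits a × Fin k) ℂ), X.PosSemidef →
      (tensorId (Fin k) Φ X).PosSemidef) ∧
    ∀ ρ : Operator a, (Φ ρ).trace = ρ.trace

/-- The trace norm: the sum of the singular values. -/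
def traceNorm {ι : Type} [Fintype ι] [DecidableEq ι] (X : Matrix ι ι ℂ) : ℝ :=
  ∑ i, Real.sqrt ((Matrix.isHermitian_conjTranspose_mul_self X).eigenvalues i)

/-- `‖Φ‖_⋄ ≤ ε`, the diamond norm being the supremum over all `k` of the norm of `Φ ⊗ 1_k`
induced by the trace norm. -/
def DiamondNormLE {a b : ℕ} (Φ : SuperOp a b) (ε : ℝ) : Prop :=
  ∀ (k : ℕ) (X : Matrix (Bits a × Fin k) (Bits a × Fin k) ℂ),
    traceNorm (tensorId (Fin k) Φ X) ≤ ε * traceNorm X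

/-- The product operator `ρ ⊗ σ` on the concatenation of two registers. -/
def tensor {a b : ℕ} (ρ : Operator a) (σ : Operator b) : Operator (a + b) :=
  Matrix.reindex (Fin.appendEquiv a b) (Fin.appendEquiv a b) (Matrix.kronecker ρ σ)

/-- `Φ ⊗ 1_E` for a register `E` of `e` qubits. -/
def applyLeft {a b : ℕ} (Φ : SuperOp a b) (e : ℕ) (X : Operator (a + e)) : Operator (b + e) :=
  Matrix.reindex (Fin.appendEquiv b e) (Fin.appendEquiv b e)
    (tensorId (Bits e) Φ
      (Matrix.reindex (Fin.appendEquiv a e).symm (Fin.appendEquiv a e).symm X))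

/-- The partial trace over the first `m` of `m + e` qubits. -/
def traceLeft (m e : ℕ) (X : Operator (m + e)) : Operator e :=
  Matrix.of fun r s => ∑ x : Bits m, X (Fin.append x r) (Fin.append x s)

/-- The superoperator `ρ ↦ Φ (|x⟩⟨x| ⊗ ρ)`: the first input register is fixed to `x`. -/
def fixLeft {k a b : ℕ} (Φ : SuperOp (k + a) b) (x : Bits k) : SuperOp a b where
  toFun ρ := Φ (tensor (basisState x) ρ)
  map_add' ρ σ := by
    rw [← map_add]
    congr 1
    ext u v
    simp [tensor, mul_add]
  map_smul' c ρ := by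
    rw [RingHom.id_apply, ← map_smul]
    congr 1
    ext u v
    simp [tensor, mul_left_comm]

/-- The probability of obtaining `x` when all qubits of `σ` are measured. -/
def outcomeProb {k : ℕ} (σ : Operator k) (x : Bits k) : ℝ := (σ x x).re

/-- The probability that the (measured) register `σ` holds exactly the bitstring `y`; it is `0`
if the register does not have the length of `y`. -/
def probReads {k : ℕ} (σ : Operator k) (y : List Bool) : ℝ :=
  ∑ x : Bits k with List.ofFn x = y, outcomeProb σ x

/-! ### Acting on some of the wires of a circuit -/

/-- The wires that are not among `w 0, w 1, …`. -/
abbrev OtherWires {k N : ℕ} (w : Fin k ↪ Fin N) : Type := {i : Fin N // ∀ j, w j ≠ i}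

/-- Splitting a basis label of `N` wires into the wires `w 0, w 1, …` and the others. -/
def split {k N : ℕ} (w : Fin k ↪ Fin N) : Bits N ≃ Bits k × (OtherWires w → Bool) where
  toFun u := (fun j => u (w j), fun i => u i)
  invFun p i := if h : ∃ j, w j = i then p.1 h.choose else p.2 ⟨i, fun j hj => h ⟨j, hj⟩⟩
  left_inv u := by
    funext i
    by_cases h : ∃ j, w j = i
    · simp only [h, dite_true]
      rw [h.choose_spec]
    · simp [h]
  right_inv p := by
    refine Prod.ext (funext fun j => ?_) (funext fun i => ?_)
    · have h : ∃ j', w j' = w j := ⟨j, rfl⟩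
      simp only [h, dite_true]
      rw [w.injective h.choose_spec]
    · have h : ¬ ∃ j, w j = i.1 := fun ⟨j, hj⟩ => i.2 j hj
      simp [h]

/-- `Φ` applied to the wires `w`, the identity on all others. -/
def onWires {k N : ℕ} (w : Fin k ↪ Fin N) (Φ : SuperOp k k) : SuperOp N N :=
  (Matrix.reindexLinearEquiv ℂ ℂ (split w).symm (split w).symm).toLinearMap ∘ₗ
    tensorId (OtherWires w → Bool) Φ ∘ₗ
      (Matrix.reindexLinearEquiv ℂ ℂ (split w) (split w)).toLinearMap

/-- The state `ρ` on the wires `w`, tensored with `|0⟩⟨0|` on all other wires. -/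
def attach {k N : ℕ} (w : Fin k ↪ Fin N) : SuperOp k N where
  toFun ρ := Matrix.of fun u v =>
    if ∀ i : OtherWires w, u i = false ∧ v i = false then
      ρ (fun j => u (w j)) (fun j => v (w j)) else 0
  map_add' ρ σ := by
    ext u v
    simp only [Matrix.of_apply, Matrix.add_apply]
    split_ifs <;> simp
  map_smul' c ρ := by
    ext u v
    simp only [Matrix.of_apply, Matrix.smul_apply, RingHom.id_apply]
    split_ifs <;> simp

/-- The reduced state of the wires `w`: all other wires are traced out. -/
def reduce {k N : ℕ} (w : Fin k ↪ Fin N) : SuperOp N k where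
  toFun X := Matrix.of fun x y =>
    ∑ z : OtherWires w → Bool, X ((split w).symm (x, z)) ((split w).symm (y, z))
  map_add' X Y := by
    ext x y
    simp [Finset.sum_add_distrib]
  map_smul' c X := by
    ext x y
    simp [Finset.mul_sum]

/-- A map from `a` to `b` qubits as a map on `max a b` wires: it reads the first `a` wires and
leaves its output on the first `b`; remaining wires are discarded before, and are reset to
`|0⟩⟨0|` after. -/
def inPlace {a b : ℕ} (Φ : SuperOp a b) : SuperOp (max a b) (max a b) :=
  attach (Fin.castLEEmb (le_max_right a b)) ∘ₗ Φ ∘ₗ reduce (Fin.castLEEmb (le_max_left a b))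

/-! ### Gate sets -/

/-- Conjugation `ρ ↦ U ρ U†`. -/
def conjBy {k : ℕ} (U : Operator k) : SuperOp k k where
  toFun ρ := U * ρ * U.conjTranspose
  map_add' ρ σ := by rw [mul_add, add_mul]
  map_smul' c ρ := by simp

/-- Measurement of all qubits in the computational basis. -/
def measureMap (k : ℕ) : SuperOp k k where
  toFun ρ := Matrix.diagonal fun x => ρ x x
  map_add' ρ σ := by
    ext x y
    by_cases h : x = y <;> simp [Matrix.diagonal, h]
  map_smul' c ρ := by
    ext x y
    by_cases h : x = y <;> simp [Matrix.diagonal, h]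

/-- The Pauli `X`, i.e. NOT. -/
def pauliX : Operator 1 := Matrix.of fun x y => if x 0 = !(y 0) then 1 else 0

/-- The Hadamard gate. -/
def hadamard : Operator 1 :=
  Matrix.of fun x y => ((if x 0 && y 0 then -1 else 1) / Real.sqrt 2 : ℝ)

/-- The gate `T = diag(1, exp(iπ/4))`. -/
def tGate : Operator 1 :=
  Matrix.diagonal fun x => if x 0 then Complex.exp (Complex.I * (Real.pi / 4 : ℝ)) else 1

/-- Controlled NOT; qubit `0` is the control. -/
def cnot : Operator 2 :=
  Matrix.of fun x y => if x 0 = y 0 ∧ x 1 = xor (y 0) (y 1) then 1 else 0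

/-- The usual elementary gates: fresh ancilla `|0⟩`, discarding and measuring a qubit, NOT, and
the unitaries `H`, `T`, `CNOT`. -/
inductive StdGate : Type
  | ancilla | discard | measure | not | had | t | cnot

/-- Numbers of input and output qubits. -/
def StdGate.arity : StdGate → ℕ × ℕ
  | ancilla => (0, 1)
  | discard => (1, 0)
  | measure => (1, 1)
  | not => (1, 1)
  | had => (1, 1)
  | t => (1, 1)
  | cnot => (2, 2)

/-- The map that an elementary gate performs. -/
def StdGate.map : (s : StdGate) → SuperOp s.arity.1 s.arity.2
  | ancilla => (attach (Fin.castLEEmb (Nat.zero_le 1)) : SuperOp 0 1)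
  | discard => (reduce (Fin.castLEEmb (Nat.zero_le 1)) : SuperOp 1 0)
  | measure => (measureMap 1 : SuperOp 1 1)
  | not => (conjBy pauliX : SuperOp 1 1)
  | had => (conjBy hadamard : SuperOp 1 1)
  | t => (conjBy tGate : SuperOp 1 1)
  | cnot => (conjBy QEnc.cnot : SuperOp 2 2)

/-- A finite gate set of admissible maps that contains the usual elementary gates (and is
therefore universal). -/
structure GateSet : Type 1 where
  Gate : Type
  finite : Finite Gate
  arity : Gate → ℕ × ℕ
  map : (g : Gate) → SuperOp (arity g).1 (arity g).2
  admissible : ∀ g, IsAdmissible (map g)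
  standard : ∀ s : StdGate, ∃ g : Gate,
    (⟨arity g, map g⟩ : Σ p : ℕ × ℕ, SuperOp p.1 p.2) = ⟨s.arity, s.map⟩

/-! ### Quantum circuits with oracle gates

`O` is the type of oracle names and `sig` gives the numbers of input and output qubits of each
oracle. -/

/-- Numbers of input and output qubits of a gate or oracle gate. -/
def opArity (G : GateSet) {O : Type} (sig : O → ℕ × ℕ) : G.Gate ⊕ O → ℕ × ℕ
  | .inl g => G.arity g
  | .inr o => sig o

/-- The maps that the oracles perform. -/
abbrev OracleMaps {O : Type} (sig : O → ℕ × ℕ) : Type := (o : O) → SuperOp (sig o).1 (sig o).2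

/-- The map of a gate or an oracle gate. -/
def opMap (G : GateSet) {O : Type} (sig : O → ℕ × ℕ) (orc : OracleMaps sig) :
    (p : G.Gate ⊕ O) → SuperOp (opArity G sig p).1 (opArity G sig p).2
  | .inl g => G.map g
  | .inr o => orc o

/-- A gate or oracle gate together with the distinct wires it acts on. -/
structure Instr (G : GateSet) {O : Type} (sig : O → ℕ × ℕ) (N : ℕ) where
  op : G.Gate ⊕ O
  wires : Fin (max (opArity G sig op).1 (opArity G sig op).2) ↪ Fin N

/-- The action of one instruction on the state of all wires. -/
def Instr.eval {G : GateSet} {O : Type} {sig : O → ℕ × ℕ} {N : ℕ} (i : Instr G sig N)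
    (orc : OracleMaps sig) : SuperOp N N :=
  onWires i.wires (inPlace (opMap G sig orc i.op))

/-- A quantum circuit with `a` input and `b` output qubits on `width ≥ 1` wires. The input is on
the first `a` wires, all other wires start in state `|0⟩`; the output is on the first `b` wires
and all other wires are traced out at the end. Instructions are listed in the order of
execution. -/
structure Circuit (G : GateSet) {O : Type} (sig : O → ℕ × ℕ) (a b : ℕ) where
  width : ℕ
  width_pos : 0 < width
  in_le : a ≤ width
  out_le : b ≤ width
  instrs : List (Instr G sig width)

/-- Executing instructions one after the other. -/
def runInstrs {G : GateSet} {O : Type} {sig : O → ℕ × ℕ} {N : ℕ} (orc : OracleMaps sig) :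
    List (Instr G sig N) → SuperOp N N
  | [] => LinearMap.id
  | i :: l => runInstrs orc l ∘ₗ i.eval orc

/-- The map that a circuit performs. -/
def Circuit.eval {G : GateSet} {O : Type} {sig : O → ℕ × ℕ} {a b : ℕ} (C : Circuit G sig a b)
    (orc : OracleMaps sig) : SuperOp a b :=
  reduce (Fin.castLEEmb C.out_le) ∘ₗ runInstrs orc C.instrs ∘ₗ attach (Fin.castLEEmb C.in_le)

/-! ### Polynomial-time uniform families -/

/-- The alphabet of circuit descriptions: two symbols for numbers in unary, and one symbol for
each gate and each oracle. -/
abbrev Sym (G : GateSet) (O : Type) : Type := Bool ⊕ (G.Gate ⊕ O)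

/-- A number in unary, followed by an end mark. -/
def unary {G : GateSet} {O : Type} (k : ℕ) : List (Sym G O) :=
  List.replicate k (Sum.inl true) ++ [Sum.inl false]

/-- The gate symbol, followed by the wires in order. -/
def Instr.describe {G : GateSet} {O : Type} {sig : O → ℕ × ℕ} {N : ℕ} (i : Instr G sig N) :
    List (Sym G O) :=
  Sum.inr i.op :: (List.ofFn fun j => unary (i.wires j : ℕ)).flatten

/-- The description of a circuit: the instructions from the last to the first, then the numbers
of wires, of inputs and of outputs. -/
def Circuit.describe {G : GateSet} {O : Type} {sig : O → ℕ × ℕ} {a b : ℕ}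
    (C : Circuit G sig a b) : List (Sym G O) :=
  C.instrs.reverse.flatMap Instr.describe ++ (unary C.width ++ (unary a ++ unary b))

/-- A quantum polynomial-time algorithm with oracle gates: a circuit for every security parameter
`n`, whose description is printed by one Turing machine on input `n` in unary in time polynomial
in `n`. -/
structure QPT (G : GateSet) {O : Type} (sig : ℕ → O → ℕ × ℕ) (a b : ℕ → ℕ) where
  circuit : (n : ℕ) → Circuit G (sig n) (a n) (b n)
  uniform : Nonempty (Turing.TM2ComputableInPolyTime Computability.unaryEncodeNat
    (fun w : List (Sym G O) => w) fun n => (circuit n).describe)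

/-- The map that the `n`th circuit performs. -/
def QPT.eval {G : GateSet} {O : Type} {sig : ℕ → O → ℕ × ℕ} {a b : ℕ → ℕ} (A : QPT G sig a b)
    (n : ℕ) (orc : OracleMaps (sig n)) : SuperOp (a n) (b n) :=
  (A.circuit n).eval orc

/-- The signature without oracles. -/
def noOracle : ℕ → Empty → ℕ × ℕ := fun _ o => o.elim

/-- The map that the `n`th circuit of an algorithm without oracles performs. -/
def QPT.map {G : GateSet} {a b : ℕ → ℕ} (A : QPT G noOracle a b) (n : ℕ) :
    SuperOp (a n) (b n) :=
  A.eval n fun o => o.elim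

/-- Negligible functions: `n ^ k * f n → 0` for every `k`. -/
def Negligible (f : ℕ → ℝ) : Prop :=
  Asymptotics.SuperpolynomialDecay Filter.atTop (fun n : ℕ => (n : ℝ)) f

/-! ### Quantum encryption schemes -/

/-- The probability that a key generation algorithm, run on `1ⁿ`, outputs `x`. -/
def keyGenProb {G : GateSet} {l : ℕ → ℕ} (K : QPT G noOracle (fun n => n) l) (n : ℕ)
    (x : Bits (l n)) : ℝ :=
  outcomeProb (K.map n (basisState fun _ => true)) x

/-- Quantum symmetric-key encryption schemes, with keys of `n` bits. -/
structure QSKE (G : GateSet) where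
  msgLen : ℕ → ℕ
  ctLen : ℕ → ℕ
  keyGen : QPT G noOracle (fun n => n) (fun n => n)
  enc : QPT G noOracle (fun n => n + msgLen n) ctLen
  dec : QPT G noOracle (fun n => n + ctLen n) msgLen
  correct : ∃ ε : ℕ → ℝ, Negligible ε ∧ ∀ (n : ℕ) (k : Bits n), 0 < keyGenProb keyGen n k →
    DiamondNormLE (fixLeft (dec.map n) k ∘ₗ fixLeft (enc.map n) k - LinearMap.id) (ε n)

/-- Quantum public-key encryption schemes; the public key has `pkLen n` bits and the secret key
has `n` bits. -/
structure QPKE (G : GateSet) where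
  pkLen : ℕ → ℕ
  msgLen : ℕ → ℕ
  ctLen : ℕ → ℕ
  keyGen : QPT G noOracle (fun n => n) (fun n => pkLen n + n)
  enc : QPT G noOracle (fun n => pkLen n + msgLen n) ctLen
  dec : QPT G noOracle (fun n => n + ctLen n) msgLen
  correct : ∃ ε : ℕ → ℝ, Negligible ε ∧ ∀ (n : ℕ) (pk : Bits (pkLen n)) (sk : Bits n),
    0 < keyGenProb keyGen n (Fin.append pk sk) →
      DiamondNormLE (fixLeft (dec.map n) sk ∘ₗ fixLeft (enc.map n) pk - LinearMap.id) (ε n)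

/-- What the security games use of a scheme: the register lengths, the distribution of the keys
(or key pairs), the classical input of the message generator, and the encryption and decryption
maps for each key. -/
structure Cipher : Type 1 where
  msgLen : ℕ → ℕ
  ctLen : ℕ → ℕ
  genLen : ℕ → ℕ
  Key : ℕ → Type
  keyFintype : (n : ℕ) → Fintype (Key n)
  keyProb : (n : ℕ) → Key n → ℝ
  genInput : (n : ℕ) → Key n → Bits (genLen n)
  enc : (n : ℕ) → Key n → SuperOp (msgLen n) (ctLen n)
  dec : (n : ℕ) → Key n → SuperOp (ctLen n) (msgLen n)

/-- Public-key setting: the message generator receives the public key. -/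
def QPKE.cipher {G : GateSet} (S : QPKE G) : Cipher where
  msgLen := S.msgLen
  ctLen := S.ctLen
  genLen := S.pkLen
  Key n := Bits (S.pkLen n) × Bits n
  keyFintype _ := inferInstance
  keyProb n k := keyGenProb S.keyGen n (Fin.append k.1 k.2)
  genInput _ k := k.1
  enc n k := fixLeft (S.enc.map n) k.1
  dec n k := fixLeft (S.dec.map n) k.2

/-- Symmetric-key setting: the message generator receives a blank input. -/
def QSKE.cipher {G : GateSet} (S : QSKE G) : Cipher where
  msgLen := S.msgLen
  ctLen := S.ctLen
  genLen _ := 0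
  Key n := Bits n
  keyFintype _ := inferInstance
  keyProb n k := keyGenProb S.keyGen n k
  genInput _ _ := Fin.elim0
  enc n k := fixLeft (S.enc.map n) k
  dec n k := fixLeft (S.dec.map n) k

/-- A quantum encryption scheme, of either kind. -/
inductive EncryptionScheme (G : GateSet)
  | pub (S : QPKE G)
  | sym (S : QSKE G)

/-- The cipher of a scheme. -/
def EncryptionScheme.cipher {G : GateSet} : EncryptionScheme G → Cipher
  | pub S => S.cipher
  | sym S => S.cipher

/-! ### The games IND and IND' -/

/-- The oracles of the games: encryption and decryption. -/
inductive Query : Type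
  | enc | dec

/-- No oracles, chosen-plaintext attack, (non-adaptive) chosen-ciphertext attack. -/
inductive Attack : Type
  | plain | cpa | cca1

/-- The oracles of the message generator. -/
def Attack.genQueries : Attack → Set Query
  | plain => ∅
  | cpa => {.enc}
  | cca1 => {.enc, .dec}

/-- The oracles of the distinguisher. -/
def Attack.distQueries : Attack → Set Query
  | plain => ∅
  | cpa => {.enc}
  | cca1 => {.enc}

/-- The oracle signature of a cipher. -/
def Cipher.sig (C : Cipher) (Q : Set Query) (n : ℕ) : Q → ℕ × ℕ
  | ⟨.enc, _⟩ => (C.msgLen n, C.ctLen n)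
  | ⟨.dec, _⟩ => (C.ctLen n, C.msgLen n)

/-- The oracles for a given key. -/
def Cipher.oracles (C : Cipher) (Q : Set Query) (n : ℕ) (k : C.Key n) :
    OracleMaps (C.sig Q n)
  | ⟨.enc, _⟩ => C.enc n k
  | ⟨.dec, _⟩ => C.dec n k

/-- An adversary: a message generator, whose output consists of the message register and an
auxiliary register `E`, and a distinguisher, which receives the ciphertext register and `E` and
outputs a string of bits. Both are quantum polynomial-time algorithms. -/
structure Adversary (G : GateSet) (C : Cipher) (t : Attack) where
  auxLen : ℕ → ℕ
  outLen : ℕ → ℕ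
  gen : QPT G (C.sig t.genQueries) C.genLen (fun n => C.msgLen n + auxLen n)
  dist : QPT G (C.sig t.distQueries) (fun n => C.ctLen n + auxLen n) outLen

namespace Adversary

variable {G : GateSet} {C : Cipher} {t : Attack} (A : Adversary G C t)

/-- The state `ρ_ME` prepared by the message generator. -/
def prepared (n : ℕ) (k : C.Key n) : Operator (C.msgLen n + A.auxLen n) :=
  A.gen.eval n (C.oracles _ n k) (basisState (C.genInput n k))

/-- The challenge state: `ρ_ME` for `b = 1`, and `|0⟩⟨0| ⊗ ρ_E` for `b = 0`. -/
def challenge (n : ℕ) (k : C.Key n) (b : Bool) : Operator (C.msgLen n + A.auxLen n) :=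
  if b then A.prepared n k
  else tensor (zeroState (C.msgLen n)) (traceLeft (C.msgLen n) (A.auxLen n) (A.prepared n k))

/-- The final output register of the distinguisher, for challenge bit `b`. -/
def output (n : ℕ) (k : C.Key n) (b : Bool) : Operator (A.outLen n) :=
  A.dist.eval n (C.oracles _ n k) (applyLeft (C.enc n k) (A.auxLen n) (A.challenge n k b))

/-- The probability, over the keys and all internal randomness, that the distinguisher outputs
the bitstring `y` when the challenge bit is `b`. -/
def outputProb (n : ℕ) (b : Bool) (y : List Bool) : ℝ :=
  letI := C.keyFintype n
  ∑ k : C.Key n, C.keyProb n k * probReads (A.output n k b) y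

/-- The distinguishing advantage of IND. -/
def advantage (n : ℕ) : ℝ := |A.outputProb n true [true] - A.outputProb n false [true]|

/-- The probability in IND' that the distinguisher outputs the uniformly random challenge bit. -/
def guessProb (n : ℕ) : ℝ := ∑ b : Bool, (1 / 2) * A.outputProb n b [b]

end Adversary

/-- IND security (plain, CPA, or CCA1). -/
def INDSecure (G : GateSet) (C : Cipher) (t : Attack) : Prop :=
  ∀ A : Adversary G C t, ∃ ε : ℕ → ℝ, Negligible ε ∧ ∀ n, A.advantage n ≤ ε n

/-- IND' security (plain, CPA, or CCA1). -/
def IND'Secure (G : GateSet) (C : Cipher) (t : Attack) : Prop :=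
  ∀ A : Adversary G C t, ∃ ε : ℕ → ℝ, Negligible ε ∧ ∀ n, A.guessProb n ≤ 1 / 2 + ε n

end QEnc

end

/-! Write p_b for the probability that the distinguisher outputs the string 1 on challenge bit b. If
its output is a single bit, then it outputs 0 with probability 1 - p_b, so the guessing probability
exceeds 1/2 by (p_1 - p_0)/2, and for the negated distinguisher by (p_0 - p_1)/2. Twice the larger
of the two is |p_1 - p_0|, the advantage (`advantage_eq_two_mul_max`). If the output has another
length, it is never the string 0 or 1, and advantage and guessing probability both vanish. Hence IND
implies IND' directly, and IND' implies IND by applying it to the adversary and to its negation.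

Two facts need work. The outcome probabilities of a one-bit output sum to 1 because every map in the
game preserves the trace and the keys are normalized (`trace_output`,
`outputProb_add_outputProb_not`). The negated distinguisher is again a QPT: appending a NOT on wire
0 exchanges the outcomes (`Circuit.probReads_flipFirst`), and since a description lists the last
instruction first, it only puts a fixed word, independent of n, in front of the description
(`Circuit.flipFirst_describe`). A Turing machine can push that word on its output stack just before
it halts (`TM2ComputableInPolyTime.prepend`). -/

namespace Turing

open StateTransition

/-! ### Turing machines that prepend a fixed word to their output -/

namespace TM2

variable {K : Type*} {Γ : K → Type*} {Λ σ : Type*}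

/-- Push the word `w` on the stack `k` (its head ends up on top), then continue with `q`. -/
def Stmt.pushWord (k : K) : List (Γ k) → Stmt Γ Λ σ → Stmt Γ Λ σ
  | [], q => q
  | a :: w, q => Stmt.pushWord k w (.push k (fun _ => a) q)

/-- Push the word `w` on the stack `k` right before halting. -/
def Stmt.prependOnHalt (k : K) (w : List (Γ k)) : Stmt Γ Λ σ → Stmt Γ Λ σ
  | .push k' f q => .push k' f (q.prependOnHalt k w)
  | .peek k' f q => .peek k' f (q.prependOnHalt k w)
  | .pop k' f q => .pop k' f (q.prependOnHalt k w)
  | .load f q => .load f (q.prependOnHalt k w)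
  | .branch f q₁ q₂ => .branch f (q₁.prependOnHalt k w) (q₂.prependOnHalt k w)
  | .goto f => .goto f
  | .halt => Stmt.pushWord k w .halt

variable [DecidableEq K]

/-- Push the word `w` on the stack `k` if the configuration is halting. -/
def Cfg.prependIfHalted (k : K) (w : List (Γ k)) : Cfg Γ Λ σ → Cfg Γ Λ σ
  | ⟨none, v, S⟩ => ⟨none, v, Function.update S k (w ++ S k)⟩
  | ⟨some l, v, S⟩ => ⟨some l, v, S⟩

theorem stepAux_pushWord (k : K) (w : List (Γ k)) (q : Stmt Γ Λ σ) (v : σ)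
    (S : ∀ k, List (Γ k)) :
    stepAux (q.pushWord k w) v S = stepAux q v (Function.update S k (w ++ S k)) := by
  induction w generalizing q with
  | nil => simp [Stmt.pushWord]
  | cons a w ih => simp [Stmt.pushWord, ih]

/-- The pushes sit only at the `halt` leaves of a statement, where nothing else can run after them,
so they amount to editing the resulting configuration. -/
theorem stepAux_prependOnHalt (k : K) (w : List (Γ k)) (q : Stmt Γ Λ σ) (v : σ)
    (S : ∀ k, List (Γ k)) :
    stepAux (q.prependOnHalt k w) v S = (stepAux q v S).prependIfHalted k w := by
  induction q generalizing v S with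
  | push k' f q ih => exact ih _ _
  | peek k' f q ih => exact ih _ _
  | pop k' f q ih => exact ih _ _
  | load f q ih => exact ih _ _
  | branch f q₁ q₂ ih₁ ih₂ =>
    simp only [Stmt.prependOnHalt, stepAux]
    cases f v
    · exact ih₂ _ _
    · exact ih₁ _ _
  | goto f => rfl
  | halt => simp [Stmt.prependOnHalt, stepAux_pushWord, Cfg.prependIfHalted]

/-- The edit intertwines the two machines: running configurations are left alone, and a halted one
has no successor whatever its stacks hold. -/
theorem step_prependOnHalt (k : K) (w : List (Γ k)) (M : Λ → Stmt Γ Λ σ) (c : Cfg Γ Λ σ) :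
    step (fun l => (M l).prependOnHalt k w) (c.prependIfHalted k w) =
      (step M c).map (Cfg.prependIfHalted k w) := by
  obtain ⟨_ | l, v, S⟩ := c
  · rfl
  · exact congrArg some (stepAux_prependOnHalt k w (M l) v S)

end TM2

/-- The machine that prepends the word `w` to the output of `tm`. -/
def FinTM2.prependOutput (tm : FinTM2) (w : List (tm.Γ tm.k₁)) : FinTM2 :=
  { tm with m := fun l => (tm.m l).prependOnHalt tm.k₁ w }

theorem prependIfHalted_haltList (tm : FinTM2) (w s : List (tm.Γ tm.k₁)) :
    TM2.Cfg.prependIfHalted tm.k₁ w (haltList tm s) =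
      (haltList (tm.prependOutput w) (w ++ s) : (tm.prependOutput w).Cfg) := by
  refine congrArg (TM2.Cfg.mk none tm.initialState) (funext fun k => ?_)
  by_cases h : k = tm.k₁
  · subst h
    simp [FinTM2.prependOutput]
    rfl
  · simp [FinTM2.prependOutput, h]

/-- `flip bind f` is the step that a bounded run iterates; an intertwiner of single steps carries
over to runs of the same length, so the time bound is unchanged. -/
theorem iterate_bind_map {α : Type*} {f g : α → Option α} {φ : α → α}
    (h : ∀ a, g (φ a) = (f a).map φ) (m : ℕ) (o : Option α) :
    (flip bind g)^[m] (o.map φ) = ((flip bind f)^[m] o).map φ := by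
  refine (Function.Semiconj.iterate_right (f := Option.map φ) (ga := flip bind f)
    (gb := flip bind g) (fun o => ?_) m o).symm
  cases o with
  | none => rfl
  | some a => exact (h a).symm

/-- If `f` is computable in polynomial time, then so is `a ↦ w ++ f a`. -/
def TM2ComputableInPolyTime.prepend {α βΓ αΓ : Type} {ea : α → List αΓ} {f : α → List βΓ}
    (h : TM2ComputableInPolyTime ea (fun w : List βΓ => w) f) (w : List βΓ) :
    TM2ComputableInPolyTime ea (fun w : List βΓ => w) (fun a => w ++ f a) where
  tm := h.tm.prependOutput (w.map h.outputAlphabet.invFun)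
  inputAlphabet := h.inputAlphabet
  outputAlphabet := h.outputAlphabet
  time := h.time
  outputsFun a :=
    { steps := (h.outputsFun a).steps
      evals_in_steps := by
        have e := iterate_bind_map (TM2.step_prependOnHalt h.tm.k₁
          (w.map h.outputAlphabet.invFun) h.tm.m) (h.outputsFun a).steps
          (some (initList h.tm ((ea a).map h.inputAlphabet.invFun)))
        have e' := (h.outputsFun a).evals_in_steps
        erw [e'] at e
        -- The initial configuration is running, hence fixed by `prependIfHalted` definitionally, so
        -- `e` starts where the new machine starts.
        refine e.trans ?_
        simp only [Option.map_some, List.map_append]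
        exact congrArg some (prependIfHalted_haltList h.tm _ _)
      steps_le_m := (h.outputsFun a).steps_le_m }

end Turing

namespace QEnc

/-! ### Trace preservation -/

/-- Trace-preserving linear maps. -/
def TracePreserving {A B : Type} [Fintype A] [Fintype B]
    (Φ : Matrix A A ℂ →ₗ[ℂ] Matrix B B ℂ) : Prop :=
  ∀ X, (Φ X).trace = X.trace

theorem TracePreserving.comp {A B C : Type} [Fintype A] [Fintype B] [Fintype C]
    {Ψ : Matrix B B ℂ →ₗ[ℂ] Matrix C C ℂ} {Φ : Matrix A A ℂ →ₗ[ℂ] Matrix B B ℂ}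
    (hΨ : TracePreserving Ψ) (hΦ : TracePreserving Φ) : TracePreserving (Ψ ∘ₗ Φ) :=
  fun X => (hΨ _).trans (hΦ X)

theorem trace_reindex {A B : Type} [Fintype A] [Fintype B] (e : A ≃ B) (X : Matrix A A ℂ) :
    (Matrix.reindex e e X).trace = X.trace :=
  Equiv.sum_comp e.symm fun a => X a a

theorem tracePreserving_tensorId {A B R : Type} [Fintype A] [Fintype B] [Fintype R]
    {Φ : Matrix A A ℂ →ₗ[ℂ] Matrix B B ℂ} (h : TracePreserving Φ) :
    TracePreserving (tensorId R Φ) := by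
  intro X
  simp only [Matrix.trace, Matrix.diag_apply, Fintype.sum_prod_type_right]
  exact Finset.sum_congr rfl fun r _ => h (Matrix.of fun x y => X (x, r) (y, r))

theorem tracePreserving_reduce {k N : ℕ} (w : Fin k ↪ Fin N) : TracePreserving (reduce w) := by
  intro X
  have e := Equiv.sum_comp (split w).symm fun u => X u u
  rw [Fintype.sum_prod_type] at e
  exact e

/-- In product coordinates `attach` is ρ ⊗ |0⟩⟨0|, which makes its trace a double sum with one
surviving term in the second factor. -/
theorem attach_split_symm {k N : ℕ} (w : Fin k ↪ Fin N) (ρ : Operator k) (x y : Bits k)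
    (z z' : OtherWires w → Bool) :
    attach w ρ ((split w).symm (x, z)) ((split w).symm (y, z')) =
      if (z = fun _ => false) ∧ z' = fun _ => false then ρ x y else 0 := by
  have hx := (split w).apply_symm_apply (x, z)
  have hy := (split w).apply_symm_apply (y, z')
  -- The inverse of `split` is defined by choice; naming its values and expressing `x`, `z`, `y`,
  -- `z'` through them leaves only the explicit forward map.
  generalize (split w).symm (x, z) = u at *
  generalize (split w).symm (y, z') = v at *
  obtain ⟨rfl, rfl⟩ := Prod.ext_iff.mp hx
  obtain ⟨rfl, rfl⟩ := Prod.ext_iff.mp hy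
  simp only [attach, LinearMap.coe_mk, AddHom.coe_mk, Matrix.of_apply, split, Equiv.coe_fn_mk,
    funext_iff, ← forall_and]

theorem tracePreserving_attach {k N : ℕ} (w : Fin k ↪ Fin N) : TracePreserving (attach w) := by
  intro ρ
  have e := Equiv.sum_comp (split w).symm fun u => attach w ρ u u
  rw [Fintype.sum_prod_type] at e
  refine e.symm.trans (Finset.sum_congr rfl fun x _ => ?_)
  simp [attach_split_symm]

theorem tracePreserving_onWires {k N : ℕ} (w : Fin k ↪ Fin N) {Φ : SuperOp k k}
    (h : TracePreserving Φ) : TracePreserving (onWires w Φ) := fun X =>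
  (trace_reindex (split w).symm _).trans
    ((tracePreserving_tensorId h _).trans (trace_reindex (split w) X))

theorem tracePreserving_inPlace {a b : ℕ} {Φ : SuperOp a b} (h : TracePreserving Φ) :
    TracePreserving (inPlace Φ) :=
  (tracePreserving_attach _).comp (h.comp (tracePreserving_reduce _))

theorem tracePreserving_applyLeft {a b : ℕ} {Φ : SuperOp a b} (h : TracePreserving Φ) (e : ℕ)
    (X : Operator (a + e)) : (applyLeft Φ e X).trace = X.trace :=
  (trace_reindex _ _).trans ((tracePreserving_tensorId h _).trans (trace_reindex _ _))

theorem trace_basisState {k : ℕ} (x : Bits k) : (basisState x).trace = 1 := by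
  simp [basisState]

theorem trace_tensor {a b : ℕ} (ρ : Operator a) (σ : Operator b) :
    (tensor ρ σ).trace = ρ.trace * σ.trace :=
  (trace_reindex _ _).trans (Matrix.trace_kronecker ρ σ)

theorem trace_traceLeft (m e : ℕ) (X : Operator (m + e)) :
    (traceLeft m e X).trace = X.trace := by
  have h := Equiv.sum_comp (Fin.appendEquiv m e) fun u => X u u
  rw [Fintype.sum_prod_type_right] at h
  exact h

theorem tracePreserving_fixLeft {k a b : ℕ} {Φ : SuperOp (k + a) b} (h : TracePreserving Φ)
    (x : Bits k) : TracePreserving (fixLeft Φ x) := fun ρ =>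
  (h _).trans (by rw [trace_tensor, trace_basisState, one_mul])

/-! ### Trace preservation and concatenation for circuits -/

section Circuits

variable {G : GateSet} {O : Type}

theorem tracePreserving_opMap {sig : O → ℕ × ℕ} {orc : OracleMaps sig}
    (h : ∀ o, TracePreserving (orc o)) (p : G.Gate ⊕ O) :
    TracePreserving (opMap G sig orc p) := by
  cases p with
  | inl g => exact (G.admissible g).2
  | inr o => exact h o

theorem tracePreserving_runInstrs {sig : O → ℕ × ℕ} {N : ℕ} {orc : OracleMaps sig}
    (h : ∀ o, TracePreserving (orc o)) (l : List (Instr G sig N)) :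
    TracePreserving (runInstrs orc l) := by
  induction l with
  | nil => exact fun _ => rfl
  | cons i l ih =>
    exact ih.comp (tracePreserving_onWires _ (tracePreserving_inPlace
      (tracePreserving_opMap h i.op)))

theorem Circuit.tracePreserving_eval {sig : O → ℕ × ℕ} {a b : ℕ} (C : Circuit G sig a b)
    {orc : OracleMaps sig} (h : ∀ o, TracePreserving (orc o)) : TracePreserving (C.eval orc) :=
  (tracePreserving_reduce _).comp
    ((tracePreserving_runInstrs h _).comp (tracePreserving_attach _))

theorem QPT.tracePreserving_map {a b : ℕ → ℕ} (A : QPT G noOracle a b) (n : ℕ) :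
    TracePreserving (A.map n) :=
  (A.circuit n).tracePreserving_eval fun o => o.elim

theorem runInstrs_append {sig : O → ℕ × ℕ} {N : ℕ} (orc : OracleMaps sig)
    (l l' : List (Instr G sig N)) :
    runInstrs orc (l ++ l') = runInstrs orc l' ∘ₗ runInstrs orc l := by
  induction l with
  | nil => rfl
  | cons i l ih => simp only [List.cons_append, runInstrs, ih, LinearMap.comp_assoc]

end Circuits

/-! ### Flipping the first wire -/

theorem sum_outcomeProb {k : ℕ} (σ : Operator k) : ∑ x, outcomeProb σ x = σ.trace.re := by
  simp [outcomeProb, Matrix.trace]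

theorem probReads_of_ne {k : ℕ} (σ : Operator k) {y : List Bool} (h : k ≠ y.length) :
    probReads σ y = 0 := by
  refine Finset.sum_eq_zero fun x hx => absurd ?_ h
  simpa using congrArg List.length (Finset.mem_filter.mp hx).2

theorem probReads_singleton (σ : Operator 1) (c : Bool) :
    probReads σ [c] = outcomeProb σ fun _ => c := by
  refine Finset.sum_eq_single_of_mem _ (by simp) fun x hx hne => absurd ?_ hne
  funext i
  have := (Finset.mem_filter.mp hx).2
  simp only [List.ofFn_succ, List.ofFn_zero, List.cons.injEq, and_true] at this
  rw [Subsingleton.elim i 0, this]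

theorem probReads_add_probReads_not (σ : Operator 1) (c : Bool) :
    probReads σ [c] + probReads σ [!c] = σ.trace.re := by
  rw [← sum_outcomeProb, ← Equiv.sum_comp (Equiv.funUnique (Fin 1) Bool).symm,
    Fintype.sum_bool, probReads_singleton, probReads_singleton]
  cases c
  · exact add_comm _ _
  · rfl

/-- `pauliX` is the permutation matrix of bit negation, so conjugation by it relabels rows and
columns. -/
theorem conjBy_pauliX_apply (ρ : Operator 1) (x y : Bits 1) :
    conjBy pauliX ρ x y = ρ (fun i => !x i) fun i => !y i := by
  have key : ∀ x y : Bits 1, pauliX x y = if y = (fun i => !x i) then 1 else 0 := by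
    intro x y
    simp only [pauliX, Matrix.of_apply, funext_iff, Fin.forall_fin_one]
    cases x 0 <;> cases y 0 <;> rfl
  simp [conjBy, Matrix.mul_apply, key, Matrix.conjTranspose_apply]

/-- Wire `0` as the only wire of a gate with one input and one output. -/
def firstWire {k N : ℕ} (hk : k = 1) (hN : 0 < N) : Fin k ↪ Fin N :=
  ⟨fun _ => ⟨0, hN⟩, fun i j _ => by subst hk; exact Subsingleton.elim i j⟩

instance isEmpty_otherWires_refl (k : ℕ) :
    IsEmpty (OtherWires (Function.Embedding.refl (Fin k))) :=
  ⟨fun i => i.2 i.1 rfl⟩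

theorem attach_refl (k : ℕ) : attach (Function.Embedding.refl (Fin k)) = LinearMap.id := by
  ext1 ρ
  ext u v
  simp [attach]

theorem reduce_refl (k : ℕ) : reduce (Function.Embedding.refl (Fin k)) = LinearMap.id := by
  have h : ∀ x z, (split (Function.Embedding.refl (Fin k))).symm (x, z) = x := fun x z =>
    (Equiv.symm_apply_eq _).mpr (Prod.ext rfl (Subsingleton.elim _ _))
  ext1 ρ
  ext u v
  simp [reduce, h]

theorem inPlace_one_one (Φ : SuperOp 1 1) : (inPlace Φ : SuperOp 1 1) = Φ := by
  -- `max 1 1` computes to 1, and both `Fin.castLEEmb` in `inPlace` become the identity embedding.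
  change attach (Function.Embedding.refl (Fin 1)) ∘ₗ Φ ∘ₗ
    reduce (Function.Embedding.refl (Fin 1)) = Φ
  rw [attach_refl, reduce_refl, LinearMap.id_comp, LinearMap.comp_id]

theorem split_symm_not {N : ℕ} (w : Fin 1 ↪ Fin N) (u : Bits N) :
    (split w).symm (fun i => !(split w u).1 i, (split w u).2) =
      Function.update u (w 0) !u (w 0) := by
  rw [Equiv.symm_apply_eq]
  refine Prod.ext (funext fun i => ?_) (funext fun i => ?_)
  · rw [Subsingleton.elim i 0]
    simp [split]
  · simp [split, Function.update_of_ne (i.2 0).symm]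

theorem onWires_conjBy_pauliX {N : ℕ} (w : Fin 1 ↪ Fin N) (X : Operator N) (u v : Bits N) :
    onWires w (conjBy pauliX) X u v =
      X (Function.update u (w 0) !u (w 0)) (Function.update v (w 0) !v (w 0)) := by
  rw [← split_symm_not, ← split_symm_not]
  exact conjBy_pauliX_apply _ _ _

/-- A gate set supplies NOT only up to an equality of dependent pairs. With the arity `p` and the
map `Φ` as variables, that equality can be eliminated by `cases`. -/
theorem onWires_inPlace_not {N : ℕ} {p : ℕ × ℕ} {Φ : SuperOp p.1 p.2}
    (hΦ : (⟨p, Φ⟩ : Σ p : ℕ × ℕ, SuperOp p.1 p.2) = ⟨StdGate.not.arity, StdGate.not.map⟩)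
    (hp : max p.1 p.2 = 1) (hN : 0 < N) (X : Operator N) (u v : Bits N) :
    onWires (firstWire hp hN) (inPlace Φ) X u v =
      X (Function.update u ⟨0, hN⟩ !u ⟨0, hN⟩) (Function.update v ⟨0, hN⟩ !v ⟨0, hN⟩) := by
  cases hΦ
  have e : (inPlace StdGate.not.map : SuperOp 1 1) = conjBy pauliX := inPlace_one_one _
  have h := onWires_conjBy_pauliX (firstWire rfl hN) X u v
  rw [← e] at h
  exact h

/-- Negating wire 0 commutes with tracing out the others, since it leaves their labels `z` fixed. On
the diagonal this exchanges the two outcomes. -/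
theorem reduce_castLE_one_apply {N : ℕ} (h : 1 ≤ N) {X Y : Operator N}
    (hXY : ∀ u v, X u v =
      Y (Function.update u ⟨0, h⟩ !u ⟨0, h⟩) (Function.update v ⟨0, h⟩ !v ⟨0, h⟩))
    (x y : Bits 1) :
    reduce (Fin.castLEEmb h) X x y =
      reduce (Fin.castLEEmb h) Y (fun i => !x i) fun i => !y i := by
  refine Finset.sum_congr rfl fun z _ => ?_
  have key : ∀ x : Bits 1, Function.update ((split (Fin.castLEEmb h)).symm (x, z)) ⟨0, h⟩
      (!(split (Fin.castLEEmb h)).symm (x, z) ⟨0, h⟩) =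
        (split (Fin.castLEEmb h)).symm (fun i => !x i, z) := by
    intro x
    have e := split_symm_not (Fin.castLEEmb h) ((split (Fin.castLEEmb h)).symm (x, z))
    rw [Equiv.apply_symm_apply] at e
    exact e.symm
  rw [hXY, key, key]

/-! ### Appending NOT to circuits and to uniform families -/

section Flip

variable {G : GateSet} {O : Type}

/-- The gate of `G` that performs NOT. -/
noncomputable def GateSet.notGate (G : GateSet) : G.Gate := (G.standard .not).choose

theorem GateSet.notGate_spec (G : GateSet) :
    (⟨G.arity G.notGate, G.map G.notGate⟩ : Σ p : ℕ × ℕ, SuperOp p.1 p.2) =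
      ⟨StdGate.not.arity, StdGate.not.map⟩ :=
  (G.standard .not).choose_spec

theorem GateSet.max_arity_notGate (G : GateSet) :
    max (G.arity G.notGate).1 (G.arity G.notGate).2 = 1 := by
  have h : G.arity G.notGate = (1, 1) := congrArg Sigma.fst G.notGate_spec
  rw [h]
  rfl

/-- NOT on wire `0`. -/
noncomputable def notFirst (G : GateSet) (sig : O → ℕ × ℕ) {N : ℕ} (hN : 0 < N) : Instr G sig N where
  op := .inl G.notGate
  wires := firstWire G.max_arity_notGate hN

theorem notFirst_describe (sig : O → ℕ × ℕ) {N : ℕ} (hN : 0 < N) :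
    (notFirst G sig hN).describe = [Sum.inr (.inl G.notGate), Sum.inl false] := by
  -- The number of wires of the gate equals 1 only propositionally, so it is made a variable. Wire 0
  -- in unary is the end mark alone.
  have key : ∀ {k : ℕ} (hk : k = 1), (List.ofFn fun j : Fin k =>
      (unary (firstWire hk hN j : ℕ) : List (Sym G O))).flatten = [Sum.inl false] := by
    rintro _ rfl
    simp only [List.ofFn_succ, List.ofFn_zero, List.flatten_cons, List.flatten_nil,
      List.append_nil]
    rfl
  exact congrArg (List.cons _) (key G.max_arity_notGate)

/-- The circuit `C` followed by NOT on wire `0`. -/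
noncomputable def Circuit.flipFirst {sig : O → ℕ × ℕ} {a b : ℕ} (C : Circuit G sig a b) :
    Circuit G sig a b :=
  { C with instrs := C.instrs ++ [notFirst G sig C.width_pos] }

theorem Circuit.flipFirst_describe {sig : O → ℕ × ℕ} {a b : ℕ} (C : Circuit G sig a b) :
    C.flipFirst.describe = [Sum.inr (.inl G.notGate), Sum.inl false] ++ C.describe := by
  simp [Circuit.describe, Circuit.flipFirst, notFirst_describe]

/-- No assumption on `b` is needed: a register of length other than 1 reads a one-bit string with
probability 0 on both sides. Wire 0 exists even for `b = 0`, as circuits have positive width. -/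
theorem Circuit.probReads_flipFirst {sig : O → ℕ × ℕ} {a b : ℕ} (C : Circuit G sig a b)
    (orc : OracleMaps sig) (σ : Operator a) (c : Bool) :
    probReads (C.flipFirst.eval orc σ) [c] = probReads (C.eval orc σ) [!c] := by
  by_cases hb : b = 1
  · subst hb
    rw [probReads_singleton, probReads_singleton]
    refine congrArg Complex.re (reduce_castLE_one_apply C.out_le (fun u v => ?_) _ _)
    change runInstrs orc (C.instrs ++ [notFirst G sig C.width_pos]) _ u v = _
    rw [runInstrs_append]
    exact onWires_inPlace_not G.notGate_spec G.max_arity_notGate C.width_pos _ u v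
  · rw [probReads_of_ne _ hb, probReads_of_ne _ hb]

/-- The algorithm `A` with the first output bit negated. -/
noncomputable def QPT.flipFirst {sig : ℕ → O → ℕ × ℕ} {a b : ℕ → ℕ} (A : QPT G sig a b) : QPT G sig a b where
  circuit n := (A.circuit n).flipFirst
  uniform := by
    obtain ⟨h⟩ := A.uniform
    simp only [Circuit.flipFirst_describe]
    -- The prepended word is the same for all `n`, so one machine serves the whole family.
    exact ⟨h.prepend _⟩

theorem QPT.probReads_flipFirst {sig : ℕ → O → ℕ × ℕ} {a b : ℕ → ℕ} (A : QPT G sig a b) (n : ℕ)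
    (orc : OracleMaps (sig n)) (σ : Operator (a n)) (c : Bool) :
    probReads (A.flipFirst.eval n orc σ) [c] = probReads (A.eval n orc σ) [!c] :=
  (A.circuit n).probReads_flipFirst orc σ c

end Flip

/-! ### Ciphers and games -/

/-- The keys are normalized, and encryption and decryption preserve traces. -/
structure Cipher.Normalized (C : Cipher) : Prop where
  sum_keyProb (n : ℕ) : letI := C.keyFintype n; ∑ k, C.keyProb n k = 1
  enc (n : ℕ) (k : C.Key n) : TracePreserving (C.enc n k)
  dec (n : ℕ) (k : C.Key n) : TracePreserving (C.dec n k)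

theorem Cipher.Normalized.oracles {C : Cipher} (h : C.Normalized) (Q : Set Query) (n : ℕ)
    (k : C.Key n) : ∀ o, TracePreserving (C.oracles Q n k o)
  | ⟨.enc, _⟩ => h.enc n k
  | ⟨.dec, _⟩ => h.dec n k

theorem sum_keyGenProb {G : GateSet} {l : ℕ → ℕ} (K : QPT G noOracle (fun n => n) l) (n : ℕ) :
    ∑ x, keyGenProb K n x = 1 := by
  have h := sum_outcomeProb (K.map n (basisState fun _ => true))
  rw [K.tracePreserving_map n, trace_basisState, Complex.one_re] at h
  exact h

theorem EncryptionScheme.normalized_cipher {G : GateSet} (S : EncryptionScheme G) :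
    S.cipher.Normalized := by
  cases S with
  | pub S =>
    refine ⟨fun n => ?_, fun n k => tracePreserving_fixLeft (S.enc.tracePreserving_map n) _,
      fun n k => tracePreserving_fixLeft (S.dec.tracePreserving_map n) _⟩
    -- Key pairs correspond bijectively to the concatenated strings that key generation outputs.
    exact (Equiv.sum_comp (Fin.appendEquiv (S.pkLen n) n) fun x => keyGenProb S.keyGen n x).trans
      (sum_keyGenProb S.keyGen n)
  | sym S =>
    exact ⟨fun n => sum_keyGenProb S.keyGen n,
      fun n k => tracePreserving_fixLeft (S.enc.tracePreserving_map n) _,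
      fun n k => tracePreserving_fixLeft (S.dec.tracePreserving_map n) _⟩

/-! ### Advantage versus guessing probability -/

namespace Adversary

variable {G : GateSet} {C : Cipher} {t : Attack}

theorem trace_output (A : Adversary G C t) (hC : C.Normalized) (n : ℕ) (k : C.Key n) (b : Bool) :
    (A.output n k b).trace = 1 := by
  have hp : (A.prepared n k).trace = 1 :=
    ((A.gen.circuit n).tracePreserving_eval (hC.oracles _ n k) _).trans (trace_basisState _)
  refine ((A.dist.circuit n).tracePreserving_eval (hC.oracles _ n k) _).trans
    ((tracePreserving_applyLeft (hC.enc n k) _ _).trans ?_)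
  cases b
  · change (tensor (zeroState _) _).trace = 1
    rw [trace_tensor, trace_traceLeft, hp, zeroState, trace_basisState, one_mul]
  · exact hp

theorem outputProb_add_outputProb_not (A : Adversary G C t) (hC : C.Normalized) {n : ℕ}
    (hn : A.outLen n = 1) (b c : Bool) :
    A.outputProb n b [c] + A.outputProb n b [!c] = 1 := by
  -- `A.outLen n` is not a variable, so the one-qubit identity is transported along an equality `m =
  -- 1`.
  have key : ∀ {m : ℕ} (_ : m = 1) (σ : Operator m),
      probReads σ [c] + probReads σ [!c] = σ.trace.re := by
    rintro _ rfl σ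
    exact probReads_add_probReads_not σ c
  let := C.keyFintype n
  simp only [outputProb]
  rw [← Finset.sum_add_distrib, ← hC.sum_keyProb n]
  refine Finset.sum_congr rfl fun k _ => ?_
  rw [← mul_add, key hn, A.trace_output hC, Complex.one_re, mul_one]

/-- This settles the security parameters at which the distinguisher does not output a single bit:
there the advantage and the guessing probability are both 0. -/
theorem outputProb_of_ne (A : Adversary G C t) {n : ℕ} (hn : A.outLen n ≠ 1) (b c : Bool) :
    A.outputProb n b [c] = 0 :=
  Finset.sum_eq_zero fun k _ => by rw [probReads_of_ne _ (by simpa using hn), mul_zero]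

theorem guessProb_eq (A : Adversary G C t) (n : ℕ) :
    A.guessProb n = 1 / 2 * (A.outputProb n true [true] + A.outputProb n false [false]) := by
  rw [guessProb, Fintype.sum_bool, mul_add]

/-- The adversary whose distinguisher negates its first output bit. -/
noncomputable def flip (A : Adversary G C t) : Adversary G C t := { A with dist := A.dist.flipFirst }

theorem outputProb_flip (A : Adversary G C t) (n : ℕ) (b c : Bool) :
    A.flip.outputProb n b [c] = A.outputProb n b [!c] :=
  Finset.sum_congr rfl fun k _ =>
    congrArg (C.keyProb n k * ·) (A.dist.probReads_flipFirst n _ _ c)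

theorem advantage_eq_two_mul_max (A : Adversary G C t) (hC : C.Normalized) {n : ℕ}
    (hn : A.outLen n = 1) :
    A.advantage n = 2 * max (A.guessProb n - 1 / 2) (A.flip.guessProb n - 1 / 2) := by
  have h₀ := A.outputProb_add_outputProb_not hC hn false true
  have h₁ := A.outputProb_add_outputProb_not hC hn true true
  rw [guessProb_eq, guessProb_eq, outputProb_flip, outputProb_flip, advantage, abs,
    mul_max_of_nonneg _ _ zero_le_two]
  -- Unfolding `abs` has made the left side the maximum of p_1 - p_0 and its negative; normalization
  -- for each challenge bit matches them with the two guessing terms.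
  simp only [Bool.not_true, Bool.not_false] at *
  exact congrArg₂ max (by linarith) (by linarith)

theorem guessProb_le (A : Adversary G C t) (hC : C.Normalized) (n : ℕ) :
    A.guessProb n ≤ 1 / 2 + A.advantage n := by
  have h0 : 0 ≤ A.advantage n := abs_nonneg _
  by_cases hn : A.outLen n = 1
  · have h := A.advantage_eq_two_mul_max hC hn
    linarith [le_max_left (A.guessProb n - 1 / 2) (A.flip.guessProb n - 1 / 2)]
  · rw [guessProb_eq, A.outputProb_of_ne hn, A.outputProb_of_ne hn]
    linarith

/-- The sum of absolute values dominates both bounds, stays nonnegative when the advantage is 0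
although `ε` and `ε'` may be negative, and is visibly negligible when they are. -/
theorem advantage_le (A : Adversary G C t) (hC : C.Normalized) {n : ℕ} {ε ε' : ℝ}
    (h : A.guessProb n ≤ 1 / 2 + ε) (h' : A.flip.guessProb n ≤ 1 / 2 + ε') :
    A.advantage n ≤ 2 * (|ε| + |ε'|) := by
  by_cases hn : A.outLen n = 1
  · rw [A.advantage_eq_two_mul_max hC hn]
    refine mul_le_mul_of_nonneg_left (max_le ?_ ?_) zero_le_two
    · linarith [le_abs_self ε, abs_nonneg ε']
    · linarith [le_abs_self ε', abs_nonneg ε]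
  · rw [advantage, A.outputProb_of_ne hn, A.outputProb_of_ne hn, sub_zero, abs_zero]
    positivity

end Adversary

theorem Negligible.abs {f : ℕ → ℝ} (hf : Negligible f) : Negligible fun n => |f n| :=
  Asymptotics.SuperpolynomialDecay.trans_abs_le hf fun n => (abs_abs (f n)).le

theorem IND'Secure_iff_INDSecure {G : GateSet} {C : Cipher} (hC : C.Normalized) (t : Attack) :
    IND'Secure G C t ↔ INDSecure G C t := by
  refine ⟨fun h A => ?_, fun h A => ?_⟩
  · obtain ⟨ε, hε, hA⟩ := h A
    obtain ⟨ε', hε', hA'⟩ := h A.flip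
    refine ⟨fun n => 2 * (|ε n| + |ε' n|), ?_, fun n => A.advantage_le hC (hA n) (hA' n)⟩
    exact (hε.abs.add hε'.abs).const_mul 2
  · obtain ⟨ε, hε, hA⟩ := h A
    exact ⟨ε, hε, fun n => (A.guessProb_le hC n).trans (by linarith [hA n])⟩

end QEnc

theorem mainTheorem7 (G : QEnc.GateSet) (S : QEnc.EncryptionScheme G) (t : QEnc.Attack) :
    (QEnc.IND'Secure G S.cipher t ↔ QEnc.INDSecure G S.cipher t) ∧
    ∀ A : QEnc.Adversary G S.cipher t,
      ∃ D' : QEnc.QPT G (S.cipher.sig t.distQueries)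
          (fun n => S.cipher.ctLen n + A.auxLen n) A.outLen,
        (∀ (n : ℕ) (orc : QEnc.OracleMaps (S.cipher.sig t.distQueries n))
            (σ : QEnc.Operator (S.cipher.ctLen n + A.auxLen n)) (c : Bool),
          QEnc.probReads (D'.eval n orc σ) [c] = QEnc.probReads (A.dist.eval n orc σ) [!c]) ∧
        ∀ n : ℕ, A.outLen n = 1 →
          A.advantage n = 2 * max (A.guessProb n - 1 / 2)
            (QEnc.Adversary.guessProb { A with dist := D' } n - 1 / 2) := by
  have hC := S.normalized_cipher
  -- The adversary with `dist` replaced by `A.dist.flipFirst` is `A.flip` by definition.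
  exact ⟨QEnc.IND'Secure_iff_INDSecure hC t, fun A =>
    ⟨A.dist.flipFirst, A.dist.probReads_flipFirst, fun n => A.advantage_eq_two_mul_max hC⟩⟩
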